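/- Let $\tau\in\mathbb C$ with $\operatorname{Im}\tau>0$, $q=e^{\pi i\tau}$, and let $$\vartheta_1(z)=-i\sum_{n\in\mathbb Z}(-1)^n e^{\pi i\tau(n+1/2)^2}e^{(2n+1)iz},\qquad \vartheta_2(z)=\sum_{n\in\mathbb Z}e^{\pi i\tau(n+1/2)^2}e^{(2n+1)iz},$$ $$\vartheta_3(z)=\sum_{n\in\mathbb Z}q^{n^2}e^{2niz},\qquad \vartheta_4(z)=\sum_{n\in\mathbb Z}(-1)^nq^{n^2}e^{2niz}$$ be the Jacobi theta functions, $\vartheta_i=\vartheta_i(0)$ for $i=2,3,4$. The Jacobi elliptic functions of modulus $k=\vartheta_2^2/\vartheta_3^2$ are $$\operatorname{sn}u=\frac{\vartheta_3}{\vartheta_2}\frac{\vartheta_1(\vartheta_3^{-2}u)}{\vartheta_4(\vartheta_3^{-2}u)},\quad \operatorname{cn}u=\frac{\vartheta_4}{\vartheta_2}\frac{\vartheta_2(\vartheta_3^{-2}u)}{\vartheta_4(\vartheta_3^{-2}u)},\quad \operatorname{dn}u=\frac{\vartheta_4}{\vartheta_3}\frac{\vartheta_3(\vartheta_3^{-2}u)}{\vartheta_4(\vartheta_3^{-2}u)}.$$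 Let $N\ge1$, $u_1,\dots,u_N,v_1,\dots,v_N\in\mathbb C$, $x_i=\vartheta_3^{-2}u_i$, $y_i=\vartheta_3^{-2}v_i$, and suppose that $\vartheta_1(x_i-y_j)\ne0$ for all $i,j$. Let $\Phi$ and $\Psi$ be the $N\times N$ matrices with entries $$\Phi_{ij}=\frac{\operatorname{dn}(u_i-v_j)}{\operatorname{sn}(u_i-v_j)},\qquad \Psi_{ij}=\operatorname{cn}(u_i-v_j),$$ where $\operatorname{dn}/\operatorname{sn}$ is understood as a meromorphic function (the common poles of $\operatorname{dn}$ and $\operatorname{sn}$ being removable singularities of it). Write $S=\sum_{i=1}^Nx_i-\sum_{i=1}^Ny_i$. 1. One has $$\det\Phi=\frac{\vartheta_2^N\vartheta_4^N}{\vartheta_3^{N+1}}\,e^{-i\left(S-\frac{\pi\tau}{4}\right)}\,\vartheta_1\!\left(S+\tfrac{\pi}{2}-\tfrac{\pi\tau}{2}\right)\frac{\prod_{i<j}\vartheta_1(x_i-x_j)\vartheta_1(y_j-y_i)}{\prod_{i,j}\vartheta_1(x_i-y_j)}.$$ 2. Suppose moreover that $\vartheta_1(x_i-x_j)\ne0$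 and $\vartheta_1(y_i-y_j)\neq0$ for all $i\ne j$, and that $\vartheta_1(S+\frac\pi2-\frac{\pi\tau}2)\ne0$. Then $\Phi$ is invertible, and for all $m,n$ $$\Phi^{-1}_{mn}=-\frac{\vartheta_3}{\vartheta_2\vartheta_4}\,\frac{e^{i(x_n-y_m)}\,\vartheta_1\!\left(\sum_{i\ne n}x_i-\sum_{i\ne m}y_i+\frac\pi2-\frac{\pi\tau}2\right)}{\vartheta_1\!\left(S+\frac\pi2-\frac{\pi\tau}2\right)\vartheta_1(x_n-y_m)}\cdot\frac{\prod_i\vartheta_1(x_n-y_i)\prod_i\vartheta_1(y_m-x_i)}{\prod_{i\ne n}\vartheta_1(x_n-x_i)\prod_{i\ne m}\vartheta_1(y_m-y_i)}.$$ 3. If in addition to the assumptions of 2 no $u_i-v_j$ is a pole of $\operatorname{cn}$, that is, $\vartheta_4(x_i-y_j)\ne0$ for all $i,j$, then for all $l,m,n$ $$(\Psi\Phi^{-1})_{ln}=i\,e^{i\left(x_n-x_l-\frac{\pi\tau}2\right)}\frac{\vartheta_3^2}{\vartheta_2^2}\,\frac{\vartheta_1\!\left(x_l-x_n+S+\frac\pi2\right)}{\vartheta_1\!\left(S+\frac\pi2-\frac{\pi\tau}2\right)}\prod_{i}\frac{\vartheta_1(x_n-y_i)}{\vartheta_1\!\left(x_l-y_i+\frac{\pi\tau}2\right)}\prod_{i\ne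 n}\frac{\vartheta_1\!\left(x_l-x_i+\frac{\pi\tau}2\right)}{\vartheta_1(x_n-x_i)},$$ $$(\Phi^{-1}\Psi)_{ml}=i\,e^{i\left(y_l-y_m-\frac{\pi\tau}2\right)}\frac{\vartheta_3^2}{\vartheta_2^2}\,\frac{\vartheta_1\!\left(y_m-y_l+S+\frac\pi2\right)}{\vartheta_1\!\left(S+\frac\pi2-\frac{\pi\tau}2\right)}\prod_{i}\frac{\vartheta_1(y_m-x_i)}{\vartheta_1\!\left(y_l-x_i-\frac{\pi\tau}2\right)}\prod_{i\ne m}\frac{\vartheta_1\!\left(y_l-y_i-\frac{\pi\tau}2\right)}{\vartheta_1(y_m-y_i)}.$$ -/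

import Mathlib

open Complex

noncomputable section

namespace EllipticCauchy

/-! Jacobi theta functions `ϑ₁, …, ϑ₄` of nome `q = exp (π i τ)`, in the normalization
`ϑ₁(z) = -i ∑ (-1)ⁿ q^((n+1/2)²) e^{(2n+1)iz}`, `ϑ₂(z) = ∑ q^((n+1/2)²) e^{(2n+1)iz}`,
`ϑ₃(z) = ∑ q^(n²) e^{2niz}`, `ϑ₄(z) = ∑ (-1)ⁿ q^(n²) e^{2niz}` (sums over `n : ℤ`), expressed
through Mathlib's `jacobiTheta₂ z τ = ∑ exp (2πinz + πin²τ)`. -/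

def theta1 (τ z : ℂ) : ℂ :=
  -I * (exp (I * (Real.pi * τ / 4 + z)) * jacobiTheta₂ (z / Real.pi + τ / 2 + 1 / 2) τ)

def theta2 (τ z : ℂ) : ℂ :=
  exp (I * (Real.pi * τ / 4 + z)) * jacobiTheta₂ (z / Real.pi + τ / 2) τ

def theta3 (τ z : ℂ) : ℂ := jacobiTheta₂ (z / Real.pi) τ

def theta4 (τ z : ℂ) : ℂ := jacobiTheta₂ (z / Real.pi + 1 / 2) τ

/-! The Jacobi elliptic functions of modulus `k = ϑ₂(0)² / ϑ₃(0)²`. -/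

def sn (τ u : ℂ) : ℂ :=
  theta3 τ 0 / theta2 τ 0 *
    (theta1 τ (u / theta3 τ 0 ^ 2) / theta4 τ (u / theta3 τ 0 ^ 2))

def cn (τ u : ℂ) : ℂ :=
  theta4 τ 0 / theta2 τ 0 *
    (theta2 τ (u / theta3 τ 0 ^ 2) / theta4 τ (u / theta3 τ 0 ^ 2))

def dn (τ u : ℂ) : ℂ :=
  theta4 τ 0 / theta3 τ 0 *
    (theta3 τ (u / theta3 τ 0 ^ 2) / theta4 τ (u / theta3 τ 0 ^ 2))

/-- The value at `u` of the meromorphic function `dn / sn`. The limit over the punctured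
neighbourhood only matters at the common poles of `dn` and `sn`, which are removable singularities
of the quotient; see `dnDivSn_eq`. -/
def dnDivSn (τ u : ℂ) : ℂ :=
  Filter.limUnder (nhdsWithin u {u}ᶜ) (fun w => dn τ w / sn τ w)

/-! Checks of the definitions. -/

theorem theta1_eq_tsum (τ z : ℂ) :
    theta1 τ z = -I * ∑' n : ℤ,
      (-1) ^ n * exp (Real.pi * I * τ * (n + 1 / 2) ^ 2) * exp ((2 * n + 1) * I * z) := by
  have hpi : (Real.pi : ℂ) ≠ 0 := by exact_mod_cast Real.pi_ne_zero
  unfold theta1 jacobiTheta₂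
  rw [← tsum_mul_left]
  congr 2
  funext n
  have h1 : ((-1 : ℂ)) ^ n = exp (n * (Real.pi * I)) := by
    rw [exp_int_mul, exp_pi_mul_I]
  rw [h1, jacobiTheta₂_term, ← exp_add, ← exp_add, ← exp_add]
  congr 1
  field_simp
  ring

theorem theta2_eq_tsum (τ z : ℂ) :
    theta2 τ z = ∑' n : ℤ,
      exp (Real.pi * I * τ * (n + 1 / 2) ^ 2) * exp ((2 * n + 1) * I * z) := by
  have hpi : (Real.pi : ℂ) ≠ 0 := by exact_mod_cast Real.pi_ne_zero
  unfold theta2 jacobiTheta₂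
  rw [← tsum_mul_left]
  congr 1
  funext n
  rw [jacobiTheta₂_term, ← exp_add, ← exp_add]
  congr 1
  field_simp
  ring

theorem theta3_eq_tsum (τ z : ℂ) :
    theta3 τ z = ∑' n : ℤ, exp (Real.pi * I * τ * n ^ 2) * exp (2 * n * I * z) := by
  have hpi : (Real.pi : ℂ) ≠ 0 := by exact_mod_cast Real.pi_ne_zero
  unfold theta3 jacobiTheta₂
  congr 1
  funext n
  rw [jacobiTheta₂_term, ← exp_add]
  congr 1
  field_simp
  ring

theorem theta4_eq_tsum (τ z : ℂ) :
    theta4 τ z = ∑' n : ℤ,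
      (-1) ^ n * exp (Real.pi * I * τ * n ^ 2) * exp (2 * n * I * z) := by
  have hpi : (Real.pi : ℂ) ≠ 0 := by exact_mod_cast Real.pi_ne_zero
  unfold theta4 jacobiTheta₂
  congr 1
  funext n
  have h1 : ((-1 : ℂ)) ^ n = exp (n * (Real.pi * I)) := by
    rw [exp_int_mul, exp_pi_mul_I]
  rw [h1, jacobiTheta₂_term, ← exp_add, ← exp_add]
  congr 1
  field_simp
  ring

theorem continuous_theta1 {τ : ℂ} (hτ : 0 < τ.im) : Continuous (theta1 τ) := by
  have h : Continuous (fun z => jacobiTheta₂ z τ) :=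
    continuous_iff_continuousAt.2 fun z => (differentiableAt_jacobiTheta₂_fst z hτ).continuousAt
  unfold theta1
  exact continuous_const.mul ((by fun_prop : Continuous fun z : ℂ =>
    exp (I * (Real.pi * τ / 4 + z))).mul (h.comp (by fun_prop)))

theorem continuous_theta3 {τ : ℂ} (hτ : 0 < τ.im) : Continuous (theta3 τ) := by
  have h : Continuous (fun z => jacobiTheta₂ z τ) :=
    continuous_iff_continuousAt.2 fun z => (differentiableAt_jacobiTheta₂_fst z hτ).continuousAt
  unfold theta3
  exact h.comp (by fun_prop)

theorem continuous_theta4 {τ : ℂ} (hτ : 0 < τ.im) : Continuous (theta4 τ) := by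
  have h : Continuous (fun z => jacobiTheta₂ z τ) :=
    continuous_iff_continuousAt.2 fun z => (differentiableAt_jacobiTheta₂_fst z hτ).continuousAt
  unfold theta4
  exact h.comp (by fun_prop)

/-- Wherever `dn u / sn u` makes literal sense, it is the value `dnDivSn τ u`. -/
theorem dnDivSn_eq {τ u : ℂ} (hτ : 0 < τ.im) (hs : sn τ u ≠ 0) :
    dnDivSn τ u = dn τ u / sn τ u := by
  have h4 : theta4 τ (u / theta3 τ 0 ^ 2) ≠ 0 := by
    intro h
    exact hs (by simp [sn, h])
  have c1 : Continuous fun w => theta1 τ (w / theta3 τ 0 ^ 2) :=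
    (continuous_theta1 hτ).comp (by fun_prop)
  have c3 : Continuous fun w => theta3 τ (w / theta3 τ 0 ^ 2) :=
    (continuous_theta3 hτ).comp (by fun_prop)
  have c4 : Continuous fun w => theta4 τ (w / theta3 τ 0 ^ 2) :=
    (continuous_theta4 hτ).comp (by fun_prop)
  have hsn : ContinuousAt (sn τ) u :=
    continuousAt_const.mul (c1.continuousAt.div c4.continuousAt h4)
  have hdn : ContinuousAt (dn τ) u :=
    continuousAt_const.mul (c3.continuousAt.div c4.continuousAt h4)
  exact ((hdn.div hsn hs).tendsto.mono_left nhdsWithin_le_nhds).limUnder_eq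

end EllipticCauchy

end

open EllipticCauchy

namespace EllipticCauchy

/-! ### Parity and half-period shifts -/

theorem pi_cast_ne_zero : (Real.pi : ℂ) ≠ 0 := by exact_mod_cast Real.pi_ne_zero

theorem theta3_neg (τ z : ℂ) : theta3 τ (-z) = theta3 τ z := by
  rw [theta3, neg_div, jacobiTheta₂_neg_left, theta3]

theorem theta4_neg (τ z : ℂ) : theta4 τ (-z) = theta4 τ z := by
  rw [theta4, theta4, ← jacobiTheta₂_neg_left, ← jacobiTheta₂_add_left]
  congr 1
  ring

theorem theta2_neg (τ z : ℂ) : theta2 τ (-z) = theta2 τ z := by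
  have h : z / Real.pi + τ / 2 = (z / Real.pi - τ / 2) + τ := by ring
  have h' : -z / Real.pi + τ / 2 = -(z / Real.pi - τ / 2) := by ring
  rw [theta2, theta2, h, h', jacobiTheta₂_neg_left, jacobiTheta₂_add_left', ← mul_assoc, ← exp_add]
  congr 2
  field_simp [pi_cast_ne_zero]
  ring

theorem theta1_add_pi_div_two (τ z : ℂ) : theta1 τ (z + Real.pi / 2) = theta2 τ z := by
  have h : (z + Real.pi / 2) / Real.pi + τ / 2 + 1 / 2 = z / Real.pi + τ / 2 + 1 := by
    field_simp [pi_cast_ne_zero]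
    ring
  have h' : I * (Real.pi * τ / 4 + (z + Real.pi / 2)) =
      I * (Real.pi * τ / 4 + z) + Real.pi / 2 * I := by ring
  rw [theta1, theta2, h, jacobiTheta₂_add_left, h', exp_add, exp_pi_div_two_mul_I]
  linear_combination (-exp (I * (Real.pi * τ / 4 + z)) * jacobiTheta₂ (z / Real.pi + τ / 2) τ) * I_sq

theorem theta1_add_half_period (τ z : ℂ) :
    theta1 τ (z + Real.pi / 2 - Real.pi * τ / 2) =
      exp (I * (z - Real.pi * τ / 4)) * theta3 τ z := by
  have h : z + Real.pi / 2 - Real.pi * τ / 2 = (z - Real.pi * τ / 2) + Real.pi / 2 := by ring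
  rw [h, theta1_add_pi_div_two, theta2, theta3]
  congr 2
  · ring
  · field_simp [pi_cast_ne_zero]
    ring

theorem theta3_add_half_period (τ z : ℂ) :
    theta3 τ (z + Real.pi * τ / 2) = exp (-I * (z + Real.pi * τ / 4)) * theta2 τ z := by
  have h : (z + Real.pi * τ / 2) / Real.pi = z / Real.pi + τ / 2 := by
    field_simp [pi_cast_ne_zero]
  rw [theta3, theta2, h, ← mul_assoc, ← exp_add]
  ring_nf
  simp

theorem theta1_add_pi_mul_div_two (τ z : ℂ) :
    theta1 τ (z + Real.pi * τ / 2) = I * exp (-I * (z + Real.pi * τ / 4)) * theta4 τ z := by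
  have h : (z + Real.pi * τ / 2) / Real.pi + τ / 2 + 1 / 2 = (z / Real.pi + 1 / 2) + τ := by
    field_simp [pi_cast_ne_zero]
    ring
  have h' : I * (Real.pi * τ / 4 + (z + Real.pi * τ / 2)) + -Real.pi * I * (τ + 2 * (z / Real.pi + 1 / 2))
      = -I * (z + Real.pi * τ / 4) + -(Real.pi * I) := by
    field_simp [pi_cast_ne_zero]
    ring
  rw [theta1, theta4, h, jacobiTheta₂_add_left', ← mul_assoc (exp _), ← exp_add, h', exp_add,
    exp_neg (Real.pi * I), exp_pi_mul_I]
  ring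

theorem theta1_neg (τ z : ℂ) : theta1 τ (-z) = -theta1 τ z := by
  have h := theta1_add_pi_div_two τ (z - Real.pi / 2)
  have h' := theta1_add_pi_mul_div_two τ (-z - Real.pi * τ / 2)
  have h'' := theta1_add_pi_mul_div_two τ (z - Real.pi * τ / 2)
  rw [sub_add_cancel] at h h' h''
  have e : -z - Real.pi * τ / 2 = -(z + Real.pi * τ / 2) := by ring
  have p : (z + Real.pi * τ / 2) / Real.pi + 1 / 2 =
      ((z - Real.pi * τ / 2) / Real.pi + 1 / 2) + τ := by
    field_simp [pi_cast_ne_zero]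
    ring
  rw [h', h'', e, theta4_neg, theta4, p, jacobiTheta₂_add_left', theta4]
  rw [← mul_assoc, mul_assoc I, ← exp_add]
  have : -I * (-(z + Real.pi * τ / 2) + Real.pi * τ / 4) +
      -Real.pi * I * (τ + 2 * ((z - Real.pi * τ / 2) / Real.pi + 1 / 2)) =
      -I * (z - Real.pi * τ / 2 + Real.pi * τ / 4) - Real.pi * I := by
    field_simp [pi_cast_ne_zero]
    ring
  rw [this, exp_sub, exp_pi_mul_I]
  ring

theorem theta1_sub_comm (τ a b : ℂ) : theta1 τ (a - b) = -theta1 τ (b - a) := by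
  rw [← theta1_neg, neg_sub]

/-! ### Analyticity -/

theorem differentiable_jacobiTheta₂_fst {τ : ℂ} (hτ : 0 < τ.im) :
    Differentiable ℂ fun z => jacobiTheta₂ z τ :=
  fun z => differentiableAt_jacobiTheta₂_fst z hτ

theorem differentiable_theta1 {τ : ℂ} (hτ : 0 < τ.im) : Differentiable ℂ (theta1 τ) := by
  have h := differentiable_jacobiTheta₂_fst hτ
  unfold theta1
  exact (((by fun_prop : Differentiable ℂ fun z : ℂ => exp (I * (Real.pi * τ / 4 + z))).mul
    (h.comp (by fun_prop : Differentiable ℂ fun z : ℂ => z / Real.pi + τ / 2 + 1 / 2))).const_mul _)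

theorem differentiable_theta2 {τ : ℂ} (hτ : 0 < τ.im) : Differentiable ℂ (theta2 τ) := by
  have h := differentiable_jacobiTheta₂_fst hτ
  unfold theta2
  exact (by fun_prop : Differentiable ℂ fun z : ℂ => exp (I * (Real.pi * τ / 4 + z))).mul
    (h.comp (by fun_prop : Differentiable ℂ fun z : ℂ => z / Real.pi + τ / 2))

theorem differentiable_theta3 {τ : ℂ} (hτ : 0 < τ.im) : Differentiable ℂ (theta3 τ) := by
  have h := differentiable_jacobiTheta₂_fst hτ
  unfold theta3
  exact h.comp (by fun_prop : Differentiable ℂ fun z : ℂ => z / Real.pi)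

theorem differentiable_theta4 {τ : ℂ} (hτ : 0 < τ.im) : Differentiable ℂ (theta4 τ) := by
  have h := differentiable_jacobiTheta₂_fst hτ
  unfold theta4
  exact h.comp (by fun_prop : Differentiable ℂ fun z : ℂ => z / Real.pi + 1 / 2)

theorem analyticOnNhd_univ {f : ℂ → ℂ} (hf : Differentiable ℂ f) :
    AnalyticOnNhd ℂ f Set.univ :=
  hf.differentiableOn.analyticOnNhd isOpen_univ

theorem eq_zero_or_eq_zero_of_entire_mul {f g : ℂ → ℂ} (hf : Differentiable ℂ f)
    (hg : Differentiable ℂ g) (h : ∀ z, f z * g z = 0) : (∀ z, f z = 0) ∨ ∀ z, g z = 0 := by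
  have hf' := analyticOnNhd_univ hf
  have hg' := analyticOnNhd_univ hg
  rcases (hf' 0 trivial).eventually_eq_zero_or_eventually_ne_zero with h0 | h0
  · left
    intro z
    exact hf'.eqOn_zero_of_preconnected_of_eventuallyEq_zero isPreconnected_univ trivial h0 trivial
  · right
    intro z
    refine hg'.eqOn_zero_of_preconnected_of_frequently_eq_zero isPreconnected_univ
      (Set.mem_univ (0 : ℂ)) (Filter.Eventually.frequently ?_) (Set.mem_univ z)
    filter_upwards [h0] with w hw
    exact (mul_eq_zero.1 (h w)).resolve_left hw

theorem eventually_ne_zero_of_entire {f : ℂ → ℂ} (hf : Differentiable ℂ f) {w : ℂ}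
    (hw : f w ≠ 0) (z : ℂ) : ∀ᶠ u in nhdsWithin z {z}ᶜ, f u ≠ 0 := by
  have hf' := analyticOnNhd_univ hf
  rcases (hf' z trivial).eventually_eq_zero_or_eventually_ne_zero with h0 | h0
  · exact absurd (hf'.eqOn_zero_of_preconnected_of_eventuallyEq_zero isPreconnected_univ
      (Set.mem_univ z) h0 (Set.mem_univ w)) hw
  · exact h0

theorem dense_ne_zero_of_entire {f : ℂ → ℂ} (hf : Differentiable ℂ f) {w : ℂ}
    (hw : f w ≠ 0) : Dense {z | f z ≠ 0} := by
  intro z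
  rw [mem_closure_iff_frequently]
  exact (eventually_ne_zero_of_entire hf hw z).frequently.filter_mono nhdsWithin_le_nhds

theorem exists_jacobiTheta₂_ne_zero {τ : ℂ} (hτ : 0 < τ.im) : ∃ z, jacobiTheta₂ z τ ≠ 0 := by
  by_contra! h0
  have hb : ∀ n : ℤ, ∀ x : ℝ, ‖jacobiTheta₂_term n x τ‖ = ‖jacobiTheta₂_term n 0 τ‖ := by
    intro n x
    simp [norm_jacobiTheta₂_term]
  have hc : ∀ n : ℤ, Continuous fun x : ℝ => jacobiTheta₂_term n x τ := by
    intro n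
    unfold jacobiTheta₂_term
    fun_prop
  have hs := intervalIntegral.hasSum_integral_of_dominated_convergence (a := 0) (b := 1)
    (μ := MeasureTheory.volume)
    (F := fun (n : ℤ) (x : ℝ) => jacobiTheta₂_term n x τ) (f := fun x : ℝ => jacobiTheta₂ x τ)
    (fun n _ => ‖jacobiTheta₂_term n 0 τ‖) (fun n => (hc n).aestronglyMeasurable)
    (fun n => Filter.Eventually.of_forall fun x _ => (hb n x).le)
    (Filter.Eventually.of_forall fun x _ => ((summable_jacobiTheta₂_term_iff 0 τ).2 hτ).norm)
    (by simp)
    (Filter.Eventually.of_forall fun x _ => hasSum_jacobiTheta₂_term x hτ)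
  simp only [h0, intervalIntegral.integral_zero] at hs
  have hz : ∀ n : ℤ, n ≠ 0 → ∫ x in (0 : ℝ)..1, jacobiTheta₂_term n x τ = 0 := by
    intro n hn
    have hn' : (2 * Real.pi * I * n : ℂ) ≠ 0 :=
      mul_ne_zero Complex.two_pi_I_ne_zero (by exact_mod_cast hn)
    simp only [jacobiTheta₂_term, exp_add]
    rw [intervalIntegral.integral_mul_const, integral_exp_mul_complex hn']
    have : exp (2 * Real.pi * I * n) = 1 := by
      rw [mul_comm]
      exact exp_int_mul_two_pi_mul_I n
    simp [this]
  have h1 : ∫ x in (0 : ℝ)..1, jacobiTheta₂_term 0 x τ = 1 := by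
    simp [jacobiTheta₂_term]
  have := hs.unique (hasSum_single 0 hz)
  rw [h1] at this
  exact zero_ne_one this

/-! ### The product identity -/

theorem hasSum_jacobiTheta₂_term_mul {τ : ℂ} (hτ : 0 < τ.im) (a b : ℂ) : HasSum
    (fun p : ℤ × ℤ => jacobiTheta₂_term p.1 a τ * jacobiTheta₂_term p.2 b τ)
    (jacobiTheta₂ a τ * jacobiTheta₂ b τ) := by
  have h := summable_mul_of_summable_norm (f := fun n => jacobiTheta₂_term n a τ)
    (g := fun n => jacobiTheta₂_term n b τ) ((summable_jacobiTheta₂_term_iff a τ).2 hτ).norm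
    ((summable_jacobiTheta₂_term_iff b τ).2 hτ).norm
  exact HasSum.mul (f := fun n => jacobiTheta₂_term n a τ)
    (g := fun n => jacobiTheta₂_term n b τ) (hasSum_jacobiTheta₂_term a hτ)
    (hasSum_jacobiTheta₂_term b hτ) h

theorem jacobiTheta₂_mul {τ : ℂ} (hτ : 0 < τ.im) (z w : ℂ) :
    jacobiTheta₂ (z + w) τ * jacobiTheta₂ (z - w) τ =
      jacobiTheta₂ (2 * z) (2 * τ) * jacobiTheta₂ (2 * w) (2 * τ) +
      (exp (2 * Real.pi * I * z + Real.pi * I * τ / 2) * jacobiTheta₂ (2 * z + τ) (2 * τ)) *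
        (exp (2 * Real.pi * I * w + Real.pi * I * τ / 2) * jacobiTheta₂ (2 * w + τ) (2 * τ)) := by
  have hτ2 : 0 < (2 * τ).im := by simpa using hτ
  have hL := hasSum_jacobiTheta₂_term_mul hτ (z + w) (z - w)
  set g : ℤ × ℤ → ℂ :=
    fun p => jacobiTheta₂_term p.1 (z + w) τ * jacobiTheta₂_term p.2 (z - w) τ with hg
  let e : ℤ × ℤ → ℤ × ℤ := fun p => (p.1 + p.2, p.1 - p.2)
  let o : ℤ × ℤ → ℤ × ℤ := fun p => (p.1 + p.2 + 1, p.1 - p.2)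
  have he : Function.Injective e := by
    rintro ⟨a, b⟩ ⟨c, d⟩ h
    simp only [e, Prod.mk.injEq] at h ⊢
    omega
  have ho : Function.Injective o := by
    rintro ⟨a, b⟩ ⟨c, d⟩ h
    simp only [o, Prod.mk.injEq] at h ⊢
    omega
  have hc : IsCompl (Set.range e) (Set.range o) := by
    rw [isCompl_iff]
    constructor
    · rw [Set.disjoint_left]
      rintro _ ⟨⟨a, b⟩, rfl⟩ ⟨⟨c, d⟩, h⟩
      simp only [e, o, Prod.mk.injEq] at h
      omega
    · refine codisjoint_iff.2 (Set.eq_univ_iff_forall.2 ?_)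
      rintro ⟨m, n⟩
      rcases Int.even_or_odd' (m + n) with ⟨k, hk | hk⟩
      · left
        refine ⟨(k, m - k), ?_⟩
        simp only [e, Prod.mk.injEq]
        omega
      · right
        refine ⟨(k, m - k - 1), ?_⟩
        simp only [o, Prod.mk.injEq]
        omega
  have hE : HasSum (g ∘ e) (jacobiTheta₂ (2 * z) (2 * τ) * jacobiTheta₂ (2 * w) (2 * τ)) := by
    convert hasSum_jacobiTheta₂_term_mul hτ2 (2 * z) (2 * w) using 1
    funext ⟨a, b⟩
    simp only [g, e, Function.comp, jacobiTheta₂_term, ← exp_add]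
    congr 1
    push_cast
    ring
  have hO : HasSum (g ∘ o)
      ((exp (2 * Real.pi * I * z + Real.pi * I * τ / 2) * jacobiTheta₂ (2 * z + τ) (2 * τ)) *
        (exp (2 * Real.pi * I * w + Real.pi * I * τ / 2) * jacobiTheta₂ (2 * w + τ) (2 * τ))) := by
    have := (hasSum_jacobiTheta₂_term_mul hτ2 (2 * z + τ) (2 * w + τ)).mul_left
      (exp (2 * Real.pi * I * z + Real.pi * I * τ / 2) *
        exp (2 * Real.pi * I * w + Real.pi * I * τ / 2))
    rw [mul_mul_mul_comm]
    refine Eq.mpr (congrArg (HasSum · _) (funext ?_)) this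
    rintro ⟨a, b⟩
    simp only [g, o, Function.comp, jacobiTheta₂_term, ← exp_add]
    congr 1
    push_cast
    ring
  exact hL.unique (HasSum.add_isCompl hc (he.hasSum_range_iff.2 hE) (ho.hasSum_range_iff.2 hO))

/-- The antisymmetric rank-two form of the product `ϑ₁(x + y) ϑ₁(x - y)`. -/
theorem exists_theta1_mul_eq {τ : ℂ} (hτ : 0 < τ.im) : ∃ E C : ℂ → ℂ, ∀ x y,
    theta1 τ (x + y) * theta1 τ (x - y) = C x * E y - E x * C y := by
  refine ⟨fun x => exp (2 * I * x + Real.pi * I * τ / 2) *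
    jacobiTheta₂ (2 * (x / Real.pi) + τ) (2 * τ), fun x => jacobiTheta₂ (2 * (x / Real.pi)) (2 * τ),
    fun x y => ?_⟩
  have h := jacobiTheta₂_mul hτ (x / Real.pi + τ / 2 + 1 / 2) (y / Real.pi)
  have h1 : (x + y) / Real.pi + τ / 2 + 1 / 2 = x / Real.pi + τ / 2 + 1 / 2 + y / Real.pi := by ring
  have h2 : (x - y) / Real.pi + τ / 2 + 1 / 2 = x / Real.pi + τ / 2 + 1 / 2 - y / Real.pi := by ring
  have h3 : 2 * (x / Real.pi + τ / 2 + 1 / 2) = 2 * (x / Real.pi) + τ + 1 := by ring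
  have h4 : 2 * (x / Real.pi) + τ + 1 + τ = 2 * (x / Real.pi) + 2 * τ + 1 := by ring
  have h5 : 2 * Real.pi * I * (x / Real.pi + τ / 2 + 1 / 2) + Real.pi * I * τ / 2 =
      2 * I * x + 3 * Real.pi * I * τ / 2 + Real.pi * I := by
    field_simp [pi_cast_ne_zero]
    ring
  have h6 : 2 * Real.pi * I * (y / Real.pi) = 2 * I * y := by
    field_simp [pi_cast_ne_zero]
  rw [h3, h4, jacobiTheta₂_add_left, jacobiTheta₂_add_left, jacobiTheta₂_add_left', h5, h6,
    exp_add _ (Real.pi * I), exp_pi_mul_I] at h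
  have h7 : exp (2 * I * x + 3 * Real.pi * I * τ / 2) *
      exp (-Real.pi * I * (2 * τ + 2 * (2 * (x / Real.pi)))) *
      exp (2 * I * x + Real.pi * I * τ / 2) = 1 := by
    rw [← exp_add, ← exp_add, exp_eq_one_iff]
    refine ⟨0, ?_⟩
    field_simp [pi_cast_ne_zero]
    push_cast
    ring
  have h8 : exp (I * (Real.pi * τ / 4 + (x + y))) * exp (I * (Real.pi * τ / 4 + (x - y))) =
      exp (2 * I * x + Real.pi * I * τ / 2) := by
    rw [← exp_add]
    congr 1
    ring
  rw [theta1, theta1, h1, h2]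
  beta_reduce
  generalize jacobiTheta₂ (x / Real.pi + τ / 2 + 1 / 2 + y / Real.pi) τ = A at *
  generalize jacobiTheta₂ (x / Real.pi + τ / 2 + 1 / 2 - y / Real.pi) τ = B at *
  generalize exp (I * (Real.pi * τ / 4 + (x + y))) = a at *
  generalize exp (I * (Real.pi * τ / 4 + (x - y))) = b at *
  rw [show -I * (a * A) * (-I * (b * B)) = I ^ 2 * (a * b) * (A * B) by ring, I_sq, h8, h]
  linear_combination (exp (2 * I * y + Real.pi * I * τ / 2) *
    jacobiTheta₂ (2 * (y / Real.pi) + τ) (2 * τ) * jacobiTheta₂ (2 * (x / Real.pi)) (2 * τ)) * h7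

/-- The three-term identity, in the form used for a Schur complement. -/
theorem theta1_three_term {τ : ℂ} (hτ : 0 < τ.im) (t x y a b : ℂ) :
    theta1 τ (x - y + t) * theta1 τ (a - b + t) * theta1 τ (x - b) * theta1 τ (a - y) -
      theta1 τ (x - b + t) * theta1 τ (a - y + t) * theta1 τ (x - y) * theta1 τ (a - b) =
    theta1 τ t * theta1 τ (x - y + (t + (a - b))) * theta1 τ (x - a) * theta1 τ (b - y) := by
  obtain ⟨E, C, h⟩ := exists_theta1_mul_eq hτ
  obtain ⟨p, hp⟩ : ∃ p, p = t + (x - y + a - b) / 2 := ⟨_, rfl⟩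
  obtain ⟨s, hs⟩ : ∃ s, s = (x - y + a - b) / 2 := ⟨_, rfl⟩
  obtain ⟨q, hq⟩ : ∃ q, q = (x - a + y - b) / 2 := ⟨_, rfl⟩
  obtain ⟨r, hr⟩ : ∃ r, r = (x - a - y + b) / 2 := ⟨_, rfl⟩
  have e1 : x - y + t = p + r := by rw [hp, hr]; ring
  have e2 : a - b + t = p - r := by rw [hp, hr]; ring
  have e3 : x - b = q + s := by rw [hq, hs]; ring
  have e4 : a - y = -(q - s) := by rw [hq, hs]; ring
  have e5 : x - b + t = p + q := by rw [hp, hq]; ring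
  have e6 : a - y + t = p - q := by rw [hp, hq]; ring
  have e7 : x - y = r + s := by rw [hr, hs]; ring
  have e8 : a - b = -(r - s) := by rw [hr, hs]; ring
  have e9 : theta1 τ t = theta1 τ (p - s) := by rw [hp, hs]; ring_nf
  have e10 : x - y + (t + (a - b)) = p + s := by rw [hp, hs]; ring
  have e11 : x - a = q + r := by rw [hq, hr]; ring
  have e12 : b - y = -(q - r) := by rw [hq, hr]; ring
  rw [e10, e1, e2, e5, e6, e3, e4, e7, e8, e9, e11, e12]
  simp only [theta1_neg]
  linear_combination (-(theta1 τ (q + s) * theta1 τ (q - s))) * h p r -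
    (C p * E r - E p * C r) * h q s +
    (theta1 τ (r + s) * theta1 τ (r - s)) * h p q + (C p * E q - E p * C q) * h r s +
    (theta1 τ (q + r) * theta1 τ (q - r)) * h p s + (C p * E s - E p * C s) * h q r

/-! ### Nonvanishing of the theta constants -/

theorem theta1_ne_zero_of_even_half_period {τ : ℂ} (hτ : 0 < τ.im) {h : ℂ → ℂ} {a κ : ℂ}
    (hd : Differentiable ℂ h) (he : ∀ z, h (-z) = h z) (hκ : κ ≠ 0)
    (ha : ∀ x, theta1 τ (x + a) * theta1 τ (x - a) = κ * h x ^ 2) (h0 : ∃ z, h z ≠ 0) :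
    theta1 τ a ≠ 0 := by
  intro hza
  obtain ⟨E, C, H⟩ := exists_theta1_mul_eq hτ
  obtain ⟨y, hy⟩ := h0
  have hsq : ∀ x, (h x * theta1 τ y - h y * theta1 τ x) * (h x * theta1 τ y + h y * theta1 τ x) = 0 := by
    intro x
    have a1 := H x 0
    have a2 := H y 0
    have a3 := (ha x).symm.trans (H x a)
    have a4 := (ha y).symm.trans (H y a)
    have a5 := H 0 a
    rw [add_zero, sub_zero] at a1 a2
    rw [zero_add, hza, zero_mul] at a5
    apply mul_left_cancel₀ hκ
    linear_combination (theta1 τ y * theta1 τ y) * a3 + (C x * E a - E x * C a) * a2 -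
      (theta1 τ x * theta1 τ x) * a4 - (C y * E a - E y * C a) * a1 +
      (C x * E y - E x * C y) * a5
  have hodd : (∀ x, theta1 τ x = 0) → False := by
    intro hall
    have := ha y
    rw [hall, zero_mul] at this
    exact mul_ne_zero hκ (pow_ne_zero 2 hy) this.symm
  have d1 := differentiable_theta1 hτ
  rcases eq_zero_or_eq_zero_of_entire_mul ((hd.mul_const _).sub (d1.const_mul _))
    ((hd.mul_const _).add (d1.const_mul _)) hsq with hh | hh
  all_goals
    refine hodd fun x => ?_
    have b1 := hh x
    have b2 := hh (-x)
    simp only [Pi.add_apply, Pi.sub_apply] at b1 b2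
    rw [he, theta1_neg] at b2
    apply mul_left_cancel₀ hy
    first
    | linear_combination (b2 - b1) / 2
    | linear_combination (b1 - b2) / 2

theorem exists_theta2_ne_zero {τ : ℂ} (hτ : 0 < τ.im) : ∃ z, theta2 τ z ≠ 0 := by
  obtain ⟨z, hz⟩ := exists_jacobiTheta₂_ne_zero hτ
  refine ⟨(z - τ / 2) * Real.pi, mul_ne_zero (exp_ne_zero _) ?_⟩
  rwa [mul_div_cancel_right₀ _ pi_cast_ne_zero, sub_add_cancel]

theorem exists_theta3_ne_zero {τ : ℂ} (hτ : 0 < τ.im) : ∃ z, theta3 τ z ≠ 0 := by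
  obtain ⟨z, hz⟩ := exists_jacobiTheta₂_ne_zero hτ
  refine ⟨z * Real.pi, ?_⟩
  rwa [theta3, mul_div_cancel_right₀ _ pi_cast_ne_zero]

theorem exists_theta4_ne_zero {τ : ℂ} (hτ : 0 < τ.im) : ∃ z, theta4 τ z ≠ 0 := by
  obtain ⟨z, hz⟩ := exists_jacobiTheta₂_ne_zero hτ
  refine ⟨(z - 1 / 2) * Real.pi, ?_⟩
  rwa [theta4, mul_div_cancel_right₀ _ pi_cast_ne_zero, sub_add_cancel]

theorem theta2_zero_ne_zero {τ : ℂ} (hτ : 0 < τ.im) : theta2 τ 0 ≠ 0 := by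
  rw [← theta1_add_pi_div_two]
  refine theta1_ne_zero_of_even_half_period hτ (κ := -1) (differentiable_theta2 hτ) (theta2_neg τ)
    (by simp) (fun x => ?_) (exists_theta2_ne_zero hτ)
  have e : x - (0 + Real.pi / 2) = -(-x + Real.pi / 2) := by ring
  rw [e, theta1_neg, zero_add, theta1_add_pi_div_two, theta1_add_pi_div_two, theta2_neg]
  ring

theorem theta3_zero_ne_zero {τ : ℂ} (hτ : 0 < τ.im) : theta3 τ 0 ≠ 0 := by
  have h : theta1 τ (0 + Real.pi / 2 - Real.pi * τ / 2) ≠ 0 := by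
    refine theta1_ne_zero_of_even_half_period hτ (κ := -exp (-(I * (Real.pi * τ / 2))))
      (differentiable_theta3 hτ) (theta3_neg τ) (by simp [exp_ne_zero]) (fun x => ?_)
      (exists_theta3_ne_zero hτ)
    have e : x - (0 + Real.pi / 2 - Real.pi * τ / 2) = -(-x + Real.pi / 2 - Real.pi * τ / 2) := by
      ring
    have e' : x + (0 + Real.pi / 2 - Real.pi * τ / 2) = x + Real.pi / 2 - Real.pi * τ / 2 := by ring
    have e'' : -(I * (Real.pi * τ / 2)) = I * (x - Real.pi * τ / 4) + I * (-x - Real.pi * τ / 4) := by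
      ring
    rw [e, theta1_neg, e', theta1_add_half_period, theta1_add_half_period, theta3_neg, e'', exp_add]
    ring
  rw [theta1_add_half_period] at h
  exact right_ne_zero_of_mul h

theorem theta4_zero_ne_zero {τ : ℂ} (hτ : 0 < τ.im) : theta4 τ 0 ≠ 0 := by
  have h : theta1 τ (0 + Real.pi * τ / 2) ≠ 0 := by
    refine theta1_ne_zero_of_even_half_period hτ (κ := exp (-(I * (Real.pi * τ / 2))))
      (differentiable_theta4 hτ) (theta4_neg τ) (exp_ne_zero _) (fun x => ?_)
      (exists_theta4_ne_zero hτ)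
    have e : x - (0 + Real.pi * τ / 2) = -(-x + Real.pi * τ / 2) := by ring
    have e'' : -(I * (Real.pi * τ / 2)) = -I * (x + Real.pi * τ / 4) + -I * (-x + Real.pi * τ / 4) := by
      ring
    rw [e, theta1_neg, zero_add, theta1_add_pi_mul_div_two, theta1_add_pi_mul_div_two, theta4_neg,
      e'', exp_add]
    linear_combination (-exp (-I * (x + Real.pi * τ / 4)) * exp (-I * (-x + Real.pi * τ / 4)) *
      theta4 τ x ^ 2) * I_sq
  rw [theta1_add_pi_mul_div_two] at h
  exact right_ne_zero_of_mul h

theorem exists_theta1_ne_zero {τ : ℂ} (hτ : 0 < τ.im) : ∃ z, theta1 τ z ≠ 0 :=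
  ⟨0 + Real.pi / 2, by rw [theta1_add_pi_div_two]; exact theta2_zero_ne_zero hτ⟩

end EllipticCauchy

namespace EllipticCauchy

/-! ### The elliptic Cauchy determinant -/

theorem det_succ_eq_mul_det_schur {K : Type*} [Field K] {n : ℕ}
    (M : Matrix (Fin (n + 1)) (Fin (n + 1)) K) (h : M 0 0 ≠ 0) :
    M.det = M 0 0 *
      (Matrix.of fun i j : Fin n => M i.succ j.succ - M i.succ 0 / M 0 0 * M 0 j.succ).det := by
  let c : Fin (n + 1) → K := Fin.cons 0 fun i => M i.succ 0 / M 0 0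
  let B : Matrix (Fin (n + 1)) (Fin (n + 1)) K := Matrix.of fun i j => M i j - c i * M 0 j
  have hB : M.det = B.det := by
    refine Matrix.det_eq_of_forall_row_eq_smul_add_const c 0 rfl fun i j => ?_
    simp [B, c]
  rw [hB, Matrix.det_succ_column_zero, Fin.sum_univ_succ, Finset.sum_eq_zero]
  · simp only [Fin.val_zero, pow_zero, one_mul, add_zero]
    congr 1
    simp [B, c]
  · intro i _
    have : B i.succ 0 = 0 := by simp [B, c, h]
    rw [this]
    simp

theorem theta1_mul_det_of_ne_zero {τ : ℂ} (hτ : 0 < τ.im) {n : ℕ} (t : ℂ)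
    (x y : Fin (n + 1) → ℂ) (hxy : ∀ i j, theta1 τ (x i - y j) ≠ 0)
    (ht : theta1 τ (t + (x 0 - y 0)) ≠ 0)
    (ih : theta1 τ (t + (x 0 - y 0)) *
      (Matrix.of fun i j : Fin n => theta1 τ (x i.succ - y j.succ + (t + (x 0 - y 0))) /
        theta1 τ (x i.succ - y j.succ)).det =
      theta1 τ (t + (x 0 - y 0)) ^ n *
        theta1 τ (∑ i : Fin n, x i.succ - ∑ i : Fin n, y i.succ + (t + (x 0 - y 0))) *
        ((∏ i : Fin n, ∏ j ∈ Finset.Ioi i,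
          theta1 τ (x i.succ - x j.succ) * theta1 τ (y j.succ - y i.succ)) /
          ∏ i : Fin n, ∏ j : Fin n, theta1 τ (x i.succ - y j.succ))) :
    theta1 τ t *
      (Matrix.of fun i j => theta1 τ (x i - y j + t) / theta1 τ (x i - y j)).det =
      theta1 τ t ^ (n + 1) * theta1 τ (∑ i, x i - ∑ i, y i + t) *
        ((∏ i, ∏ j ∈ Finset.Ioi i, theta1 τ (x i - x j) * theta1 τ (y j - y i)) /
          ∏ i, ∏ j, theta1 τ (x i - y j)) := by
  have e : x 0 - y 0 + t = t + (x 0 - y 0) := by ring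
  rw [det_succ_eq_mul_det_schur]
  swap
  · rw [Matrix.of_apply, e]
    exact div_ne_zero ht (hxy 0 0)
  have hM : (Matrix.of fun i j : Fin n =>
      (Matrix.of fun i j => theta1 τ (x i - y j + t) / theta1 τ (x i - y j)) i.succ j.succ -
        (Matrix.of fun i j => theta1 τ (x i - y j + t) / theta1 τ (x i - y j)) i.succ 0 /
        (Matrix.of fun i j => theta1 τ (x i - y j + t) / theta1 τ (x i - y j)) 0 0 *
        (Matrix.of fun i j => theta1 τ (x i - y j + t) / theta1 τ (x i - y j)) 0 j.succ) =
      Matrix.of fun i j => (theta1 τ t / theta1 τ (t + (x 0 - y 0)) *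
          (theta1 τ (x i.succ - x 0) / theta1 τ (x i.succ - y 0))) *
        (Matrix.of fun i j => (theta1 τ (y 0 - y j.succ) / theta1 τ (x 0 - y j.succ)) *
          (Matrix.of fun i j : Fin n => theta1 τ (x i.succ - y j.succ + (t + (x 0 - y 0))) /
            theta1 τ (x i.succ - y j.succ)) i j) i j := by
    ext i j
    simp only [Matrix.of_apply]
    have h3 := theta1_three_term hτ t (x i.succ) (y j.succ) (x 0) (y 0)
    rw [e] at h3 ⊢
    have h1 := hxy i.succ j.succ
    have h2 := hxy i.succ 0
    have h4 := hxy 0 j.succ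
    have h5 := hxy 0 0
    field_simp
    linear_combination h3
  rw [hM, Matrix.det_mul_column, Matrix.det_mul_row]
  have hS : ∑ i, x i - ∑ i, y i + t =
      ∑ i : Fin n, x i.succ - ∑ i : Fin n, y i.succ + (t + (x 0 - y 0)) := by
    rw [Fin.sum_univ_succ, Fin.sum_univ_succ]
    ring
  have hP : ∏ j : Fin n, theta1 τ (x 0 - x j.succ) * theta1 τ (y j.succ - y 0) =
      (∏ j : Fin n, theta1 τ (x j.succ - x 0)) * ∏ j : Fin n, theta1 τ (y 0 - y j.succ) := by
    rw [← Finset.prod_mul_distrib]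
    refine Finset.prod_congr rfl fun j _ => ?_
    rw [theta1_sub_comm τ (x 0), theta1_sub_comm τ _ (y 0)]
    ring
  rw [hS, Matrix.of_apply, e, Fin.prod_univ_succ (n := n), Fin.prod_univ_succ (n := n),
    Fin.prod_Ioi_zero, hP]
  simp only [Fin.prod_Ioi_succ, Fin.prod_univ_succ (n := n), Finset.prod_mul_distrib,
    Finset.prod_div_distrib, Finset.prod_const, Finset.card_univ, Fintype.card_fin] at ih ⊢
  have n1 : ∏ i : Fin n, theta1 τ (x i.succ - y 0) ≠ 0 :=
    Finset.prod_ne_zero_iff.2 fun i _ => hxy _ _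
  have n2 : ∏ j : Fin n, theta1 τ (x 0 - y j.succ) ≠ 0 :=
    Finset.prod_ne_zero_iff.2 fun i _ => hxy _ _
  have n3 : ∏ i : Fin n, ∏ j : Fin n, theta1 τ (x i.succ - y j.succ) ≠ 0 :=
    Finset.prod_ne_zero_iff.2 fun i _ => Finset.prod_ne_zero_iff.2 fun j _ => hxy _ _
  have n4 := hxy 0 0
  generalize theta1 τ (t + (x 0 - y 0)) = b at *
  generalize (Matrix.of fun i j : Fin n => theta1 τ (x i.succ - y j.succ + (t + (x 0 - y 0))) /
        theta1 τ (x i.succ - y j.succ)).det = D at *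
  generalize theta1 τ (∑ i : Fin n, x i.succ - ∑ i : Fin n, y i.succ + (t + (x 0 - y 0))) = T at *
  generalize ∏ i : Fin n, ∏ j : Fin n, theta1 τ (x i.succ - y j.succ) = Q at *
  generalize ∏ i : Fin n, theta1 τ (x i.succ - y 0) = U at *
  generalize ∏ i : Fin n, theta1 τ (x 0 - y i.succ) = V at *
  generalize theta1 τ (x 0 - y 0) = c at *
  generalize theta1 τ t = a at *
  field_simp at ih ⊢
  linear_combination (a ^ (n + 1) * (∏ i : Fin n, theta1 τ (x i.succ - x 0)) *
    (∏ j : Fin n, theta1 τ (y 0 - y j.succ))) * ih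

theorem theta1_mul_det {τ : ℂ} (hτ : 0 < τ.im) {n : ℕ} (t : ℂ)
    (x y : Fin n → ℂ) (hxy : ∀ i j, theta1 τ (x i - y j) ≠ 0) :
    theta1 τ t *
      (Matrix.of fun i j => theta1 τ (x i - y j + t) / theta1 τ (x i - y j)).det =
      theta1 τ t ^ n * theta1 τ (∑ i, x i - ∑ i, y i + t) *
        ((∏ i, ∏ j ∈ Finset.Ioi i, theta1 τ (x i - x j) * theta1 τ (y j - y i)) /
          ∏ i, ∏ j, theta1 τ (x i - y j)) := by
  induction n generalizing t with
  | zero => simp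
  | succ n ih =>
    obtain ⟨w, hw⟩ := exists_theta1_ne_zero hτ
    have hc := continuous_theta1 hτ
    have hd : Dense {t | theta1 τ (t + (x 0 - y 0)) ≠ 0} :=
      dense_ne_zero_of_entire (f := fun t => theta1 τ (t + (x 0 - y 0)))
        ((differentiable_theta1 hτ).comp (by fun_prop)) (w := w - (x 0 - y 0))
        (by rwa [sub_add_cancel])
    refine congr_fun (Continuous.ext_on hd ?_ ?_ (f := fun t => theta1 τ t *
      (Matrix.of fun i j => theta1 τ (x i - y j + t) / theta1 τ (x i - y j)).det)
      (g := fun t => theta1 τ t ^ (n + 1) * theta1 τ (∑ i, x i - ∑ i, y i + t) *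
        ((∏ i, ∏ j ∈ Finset.Ioi i, theta1 τ (x i - x j) * theta1 τ (y j - y i)) /
          ∏ i, ∏ j, theta1 τ (x i - y j))) ?_) t
    · refine hc.mul (Continuous.matrix_det (continuous_matrix fun i j => ?_))
      exact (hc.comp (by fun_prop)).div_const _
    · exact ((hc.pow _).mul (hc.comp (by fun_prop))).mul_const _
    · intro s hs
      exact theta1_mul_det_of_ne_zero hτ s x y hxy hs
        (ih _ (fun i => x i.succ) (fun i => y i.succ) fun i j => hxy _ _)

/-- The elliptic Cauchy matrix `ϑ₃(xᵢ - yⱼ) / ϑ₁(xᵢ - yⱼ)`. -/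
noncomputable def thetaCauchy (τ : ℂ) {n : ℕ} (x y : Fin n → ℂ) : Matrix (Fin n) (Fin n) ℂ :=
  Matrix.of fun i j => theta3 τ (x i - y j) / theta1 τ (x i - y j)

theorem theta3_eq_exp_mul_theta1 (τ z : ℂ) :
    theta3 τ z = exp (-I * (z - Real.pi * τ / 4)) *
      theta1 τ (z + (Real.pi / 2 - Real.pi * τ / 2)) := by
  rw [← add_sub_assoc, theta1_add_half_period, ← mul_assoc, ← exp_add]
  ring_nf
  simp

theorem theta3_mul_det_thetaCauchy {τ : ℂ} (hτ : 0 < τ.im) {n : ℕ}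
    (x y : Fin n → ℂ) (hxy : ∀ i j, theta1 τ (x i - y j) ≠ 0) :
    theta3 τ 0 * (thetaCauchy τ x y).det =
      theta3 τ 0 ^ n * theta3 τ (∑ i, x i - ∑ i, y i) *
        ((∏ i, ∏ j ∈ Finset.Ioi i, theta1 τ (x i - x j) * theta1 τ (y j - y i)) /
          ∏ i, ∏ j, theta1 τ (x i - y j)) := by
  have h := theta1_mul_det hτ (Real.pi / 2 - Real.pi * τ / 2) x y hxy
  have hM : thetaCauchy τ x y = Matrix.of fun i j => exp (-I * x i) *
      (Matrix.of fun i j => exp (I * (y j + Real.pi * τ / 4)) * (Matrix.of fun i j =>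
        theta1 τ (x i - y j + (Real.pi / 2 - Real.pi * τ / 2)) / theta1 τ (x i - y j)) i j) i j := by
    ext i j
    simp only [thetaCauchy, Matrix.of_apply]
    rw [theta3_eq_exp_mul_theta1, ← mul_assoc, ← exp_add, mul_div_assoc]
    ring_nf
  have e1 : ∑ i, -I * x i = -I * ∑ i, x i := by rw [Finset.mul_sum]
  have e2 : ∑ i, I * (y i + Real.pi * τ / 4) = I * ∑ i, y i + n * (I * (Real.pi * τ / 4)) := by
    simp [mul_add, Finset.sum_add_distrib, Finset.mul_sum]
  rw [hM, Matrix.det_mul_column, Matrix.det_mul_row, ← exp_sum, ← exp_sum, e1, e2,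
    theta3_eq_exp_mul_theta1 τ (_ - _), theta3_eq_exp_mul_theta1 τ 0, zero_add, mul_pow,
    ← exp_nat_mul]
  have e3 : exp (-I * (0 - Real.pi * τ / 4)) *
      (exp (-I * ∑ i, x i) * exp (I * ∑ i, y i + n * (I * (Real.pi * τ / 4)))) =
      exp (n * (-I * (0 - Real.pi * τ / 4))) *
        exp (-I * (∑ i, x i - ∑ i, y i - Real.pi * τ / 4)) := by
    simp only [← exp_add]
    ring_nf
  linear_combination (exp (-I * (0 - Real.pi * τ / 4)) *
      (exp (-I * ∑ i, x i) * exp (I * ∑ i, y i + n * (I * (Real.pi * τ / 4))))) * h +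
    (theta1 τ (Real.pi / 2 - Real.pi * τ / 2) ^ n *
      theta1 τ (∑ i, x i - ∑ i, y i + (Real.pi / 2 - Real.pi * τ / 2)) *
        ((∏ i, ∏ j ∈ Finset.Ioi i, theta1 τ (x i - x j) * theta1 τ (y j - y i)) /
          ∏ i, ∏ j, theta1 τ (x i - y j))) * e3

end EllipticCauchy

namespace EllipticCauchy

/-! ### The inverse of the elliptic Cauchy matrix -/

@[to_additive]
theorem prod_erase_zero {M : Type*} [CommMonoid M] {n : ℕ} (f : Fin (n + 1) → M) :
    ∏ i ∈ Finset.univ.erase 0, f i = ∏ i : Fin n, f i.succ := by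
  have h : (Finset.univ.erase 0 : Finset (Fin (n + 1))) = Finset.univ.map (Fin.succEmb n) := by
    ext i
    cases i using Fin.cases <;> simp
  rw [h, Finset.prod_map]
  rfl

@[to_additive]
theorem prod_erase_comp_perm {M ι : Type*} [CommMonoid M] [Fintype ι] [DecidableEq ι]
    (σ : Equiv.Perm ι) (a : ι) (f : ι → M) :
    ∏ i ∈ Finset.univ.erase a, f (σ i) = ∏ i ∈ Finset.univ.erase (σ a), f i :=
  Finset.prod_equiv σ (by simp) (by simp)

theorem vecMul_inv_apply {K ι : Type*} [Field K] [Fintype ι] [DecidableEq ι]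
    (A : Matrix ι ι K) (b : ι → K) (i : ι) :
    Matrix.vecMul b A⁻¹ i = (A.updateRow i b).det / A.det := by
  rw [← Matrix.cramer_transpose_apply, Matrix.cramer_eq_adjugate_mulVec, ← Matrix.adjugate_transpose,
    Matrix.mulVec_transpose, Matrix.inv_def, Ring.inverse_eq_inv', Matrix.vecMul_smul,
    Pi.smul_apply, smul_eq_mul, div_eq_inv_mul]

theorem thetaCauchy_comp_perm (τ : ℂ) {n : ℕ} (x y : Fin n → ℂ) (σ ρ : Equiv.Perm (Fin n)) :
    thetaCauchy τ (x ∘ σ) (y ∘ ρ) = (thetaCauchy τ x y).submatrix σ ρ := rfl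

theorem det_thetaCauchy_ne_zero {τ : ℂ} (hτ : 0 < τ.im) {n : ℕ} {x y : Fin n → ℂ}
    (hxy : ∀ i j, theta1 τ (x i - y j) ≠ 0)
    (hx : ∀ i j, i ≠ j → theta1 τ (x i - x j) ≠ 0) (hy : ∀ i j, i ≠ j → theta1 τ (y i - y j) ≠ 0)
    (hS : theta3 τ (∑ i, x i - ∑ i, y i) ≠ 0) : (thetaCauchy τ x y).det ≠ 0 := by
  have h := theta3_mul_det_thetaCauchy hτ x y hxy
  refine right_ne_zero_of_mul (h.trans_ne (mul_ne_zero (mul_ne_zero (pow_ne_zero _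
    (theta3_zero_ne_zero hτ)) hS) (div_ne_zero ?_ ?_)))
  · refine Finset.prod_ne_zero_iff.2 fun i _ => Finset.prod_ne_zero_iff.2 fun j hj => ?_
    have hij : i < j := Finset.mem_Ioi.1 hj
    exact mul_ne_zero (hx i j hij.ne) (hy j i hij.ne')
  · exact Finset.prod_ne_zero_iff.2 fun i _ => Finset.prod_ne_zero_iff.2 fun j _ => hxy i j

theorem prod_theta1_sub_comm (τ : ℂ) {n : ℕ} (a : ℂ) (f : Fin n → ℂ) :
    ∏ i, theta1 τ (f i - a) = (-1) ^ n * ∏ i, theta1 τ (a - f i) := by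
  simp only [theta1_sub_comm τ _ a]
  rw [Finset.prod_neg]
  simp

theorem thetaCauchy_inv_zero_zero {τ : ℂ} (hτ : 0 < τ.im) {n : ℕ} {x y : Fin (n + 1) → ℂ}
    (hxy : ∀ i j, theta1 τ (x i - y j) ≠ 0)
    (hx : ∀ i j, i ≠ j → theta1 τ (x i - x j) ≠ 0) (hy : ∀ i j, i ≠ j → theta1 τ (y i - y j) ≠ 0)
    (hS : theta3 τ (∑ i, x i - ∑ i, y i) ≠ 0) :
    (thetaCauchy τ x y)⁻¹ 0 0 = -(1 / theta3 τ 0) *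
      (theta3 τ (∑ i ∈ Finset.univ.erase 0, x i - ∑ i ∈ Finset.univ.erase 0, y i) /
        (theta3 τ (∑ i, x i - ∑ i, y i) * theta1 τ (x 0 - y 0))) *
      (((∏ i, theta1 τ (x 0 - y i)) * ∏ i, theta1 τ (y 0 - x i)) /
        ((∏ i ∈ Finset.univ.erase 0, theta1 τ (x 0 - x i)) *
          ∏ i ∈ Finset.univ.erase 0, theta1 τ (y 0 - y i))) := by
  have hdet := det_thetaCauchy_ne_zero hτ hxy hx hy hS
  have h3 := theta3_zero_ne_zero hτ
  have hn := theta3_mul_det_thetaCauchy hτ x y hxy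
  have hm := theta3_mul_det_thetaCauchy hτ (fun i : Fin n => x i.succ) (fun i => y i.succ)
    fun i j => hxy _ _
  have hsub : (thetaCauchy τ x y).submatrix (Fin.succAbove 0) (Fin.succAbove 0) =
    thetaCauchy τ (fun i : Fin n => x i.succ) (fun i => y i.succ) := rfl
  have hinv : (thetaCauchy τ x y)⁻¹ 0 0 =
      (thetaCauchy τ (fun i : Fin n => x i.succ) (fun i => y i.succ)).det /
        (thetaCauchy τ x y).det := by
    rw [Matrix.inv_def, Ring.inverse_eq_inv', Matrix.smul_apply,
      Matrix.adjugate_fin_succ_eq_det_submatrix, hsub]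
    simp [div_eq_inv_mul]
  rw [hinv, div_eq_iff hdet]
  apply mul_left_cancel₀ h3
  rw [mul_left_comm, hn, hm]
  simp only [prod_erase_zero, sum_erase_zero, Fin.prod_univ_succ (n := n), Fin.prod_Ioi_zero,
    Fin.prod_Ioi_succ, Finset.prod_mul_distrib]
  rw [prod_theta1_sub_comm τ (y 0) (fun i : Fin n => y i.succ),
    prod_theta1_sub_comm τ (y 0) (fun i : Fin n => x i.succ), theta1_sub_comm τ (y 0) (x 0)]
  have m1 : ∏ i : Fin n, theta1 τ (x 0 - y i.succ) ≠ 0 :=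
    Finset.prod_ne_zero_iff.2 fun i _ => hxy _ _
  have m2 : ∏ i : Fin n, theta1 τ (y 0 - x i.succ) ≠ 0 :=
    Finset.prod_ne_zero_iff.2 fun i _ => by
      rw [theta1_sub_comm]
      exact neg_ne_zero.2 (hxy _ _)
  have m3 : ∏ i : Fin n, ∏ j : Fin n, theta1 τ (x i.succ - y j.succ) ≠ 0 :=
    Finset.prod_ne_zero_iff.2 fun i _ => Finset.prod_ne_zero_iff.2 fun j _ => hxy _ _
  have m4 : ∏ i : Fin n, theta1 τ (x 0 - x i.succ) ≠ 0 :=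
    Finset.prod_ne_zero_iff.2 fun i _ => hx _ _ (Fin.succ_ne_zero i).symm
  have m5 : ∏ i : Fin n, theta1 τ (y 0 - y i.succ) ≠ 0 :=
    Finset.prod_ne_zero_iff.2 fun i _ => hy _ _ (Fin.succ_ne_zero i).symm
  have m6 := hxy 0 0
  have m7 : ((-1 : ℂ)) ^ n ≠ 0 := pow_ne_zero _ (by norm_num)
  field_simp
  ring

theorem thetaCauchy_inv_apply {τ : ℂ} (hτ : 0 < τ.im) {n : ℕ} {x y : Fin n → ℂ}
    (hxy : ∀ i j, theta1 τ (x i - y j) ≠ 0)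
    (hx : ∀ i j, i ≠ j → theta1 τ (x i - x j) ≠ 0) (hy : ∀ i j, i ≠ j → theta1 τ (y i - y j) ≠ 0)
    (hS : theta3 τ (∑ i, x i - ∑ i, y i) ≠ 0) (k l : Fin n) :
    (thetaCauchy τ x y)⁻¹ k l = -(1 / theta3 τ 0) *
      (theta3 τ (∑ i ∈ Finset.univ.erase l, x i - ∑ i ∈ Finset.univ.erase k, y i) /
        (theta3 τ (∑ i, x i - ∑ i, y i) * theta1 τ (x l - y k))) *
      (((∏ i, theta1 τ (x l - y i)) * ∏ i, theta1 τ (y k - x i)) /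
        ((∏ i ∈ Finset.univ.erase l, theta1 τ (x l - x i)) *
          ∏ i ∈ Finset.univ.erase k, theta1 τ (y k - y i))) := by
  obtain _ | n := n
  · exact k.elim0
  let σ := Equiv.swap 0 l
  let ρ := Equiv.swap 0 k
  have hσ : σ 0 = l := Equiv.swap_apply_left _ _
  have hρ : ρ 0 = k := Equiv.swap_apply_left _ _
  have h := thetaCauchy_inv_zero_zero hτ (x := x ∘ σ) (y := y ∘ ρ) (fun i j => hxy _ _)
    (fun i j hij => hx _ _ (σ.injective.ne hij)) (fun i j hij => hy _ _ (ρ.injective.ne hij))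
    (by simpa only [Function.comp_apply, Equiv.sum_comp] using hS)
  rw [thetaCauchy_comp_perm, Matrix.inv_submatrix_equiv] at h
  simp only [Function.comp_apply, Matrix.submatrix_apply, hσ, hρ] at h
  rw [Equiv.sum_comp σ x, Equiv.sum_comp ρ y, sum_erase_comp_perm σ 0 x, sum_erase_comp_perm ρ 0 y,
    Equiv.prod_comp ρ (fun i => theta1 τ (x l - y i)),
    Equiv.prod_comp σ (fun i => theta1 τ (y k - x i)),
    prod_erase_comp_perm σ 0 (fun i => theta1 τ (x l - x i)),
    prod_erase_comp_perm ρ 0 (fun i => theta1 τ (y k - y i)), hσ, hρ] at h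
  exact h

theorem vecMul_thetaCauchy_inv_zero {τ : ℂ} (hτ : 0 < τ.im) {n : ℕ} {x y : Fin (n + 1) → ℂ}
    (hxy : ∀ i j, theta1 τ (x i - y j) ≠ 0)
    (hx : ∀ i j, i ≠ j → theta1 τ (x i - x j) ≠ 0) (hy : ∀ i j, i ≠ j → theta1 τ (y i - y j) ≠ 0)
    (hS : theta3 τ (∑ i, x i - ∑ i, y i) ≠ 0) (z : ℂ) (hz : ∀ i, theta1 τ (z - y i) ≠ 0) :
    Matrix.vecMul (fun j => theta3 τ (z - y j) / theta1 τ (z - y j)) (thetaCauchy τ x y)⁻¹ 0 =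
      theta3 τ (z - x 0 + (∑ i, x i - ∑ i, y i)) / theta3 τ (∑ i, x i - ∑ i, y i) *
        (∏ i, theta1 τ (x 0 - y i) / theta1 τ (z - y i)) *
        ∏ i ∈ Finset.univ.erase 0, theta1 τ (z - x i) / theta1 τ (x 0 - x i) := by
  have hdet := det_thetaCauchy_ne_zero hτ hxy hx hy hS
  have h3 := theta3_zero_ne_zero hτ
  have hn := theta3_mul_det_thetaCauchy hτ x y hxy
  let x' : Fin (n + 1) → ℂ := Fin.cons z fun i => x i.succ
  have hm := theta3_mul_det_thetaCauchy hτ x' y fun i j => by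
    cases i using Fin.cases
    · exact hz j
    · exact hxy _ j
  have hrow : (thetaCauchy τ x y).updateRow 0 (fun j => theta3 τ (z - y j) / theta1 τ (z - y j)) =
      thetaCauchy τ x' y := by
    ext i j
    cases i using Fin.cases
    · simp [thetaCauchy, x']
    · simp [thetaCauchy, x', Matrix.updateRow_apply]
  rw [vecMul_inv_apply, hrow, div_eq_iff hdet]
  apply mul_left_cancel₀ h3
  rw [mul_left_comm, hn, hm]
  have hs : ∑ i, x' i - ∑ i, y i = z - x 0 + (∑ i, x i - ∑ i, y i) := by
    rw [Fin.sum_univ_succ x', Fin.sum_univ_succ x]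
    simp only [x', Fin.cons_zero, Fin.cons_succ]
    ring
  rw [hs, Fin.prod_univ_succ (fun i => ∏ j ∈ Finset.Ioi i, _),
    Fin.prod_univ_succ (fun i => ∏ j ∈ Finset.Ioi i, _), Fin.prod_univ_succ (fun i => ∏ j, _),
    Fin.prod_univ_succ (fun i => ∏ j, _)]
  simp only [prod_erase_zero, Fin.prod_Ioi_zero, Fin.prod_Ioi_succ, Finset.prod_mul_distrib,
    Finset.prod_div_distrib, x', Fin.cons_zero, Fin.cons_succ]
  have m1 : ∏ i, theta1 τ (x 0 - y i) ≠ 0 := Finset.prod_ne_zero_iff.2 fun i _ => hxy _ _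
  have m2 : ∏ i, theta1 τ (z - y i) ≠ 0 := Finset.prod_ne_zero_iff.2 fun i _ => hz _
  have m3 : ∏ i : Fin n, ∏ j, theta1 τ (x i.succ - y j) ≠ 0 :=
    Finset.prod_ne_zero_iff.2 fun i _ => Finset.prod_ne_zero_iff.2 fun j _ => hxy _ _
  have m4 : ∏ i : Fin n, theta1 τ (x 0 - x i.succ) ≠ 0 :=
    Finset.prod_ne_zero_iff.2 fun i _ => hx _ _ (Fin.succ_ne_zero i).symm
  field_simp

theorem vecMul_thetaCauchy_inv {τ : ℂ} (hτ : 0 < τ.im) {n : ℕ} {x y : Fin n → ℂ}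
    (hxy : ∀ i j, theta1 τ (x i - y j) ≠ 0)
    (hx : ∀ i j, i ≠ j → theta1 τ (x i - x j) ≠ 0) (hy : ∀ i j, i ≠ j → theta1 τ (y i - y j) ≠ 0)
    (hS : theta3 τ (∑ i, x i - ∑ i, y i) ≠ 0) (z : ℂ) (hz : ∀ i, theta1 τ (z - y i) ≠ 0)
    (l : Fin n) :
    Matrix.vecMul (fun j => theta3 τ (z - y j) / theta1 τ (z - y j)) (thetaCauchy τ x y)⁻¹ l =
      theta3 τ (z - x l + (∑ i, x i - ∑ i, y i)) / theta3 τ (∑ i, x i - ∑ i, y i) *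
        (∏ i, theta1 τ (x l - y i) / theta1 τ (z - y i)) *
        ∏ i ∈ Finset.univ.erase l, theta1 τ (z - x i) / theta1 τ (x l - x i) := by
  obtain _ | n := n
  · exact l.elim0
  let σ := Equiv.swap 0 l
  have hσ : σ 0 = l := Equiv.swap_apply_left _ _
  have h := vecMul_thetaCauchy_inv_zero hτ (x := x ∘ σ) (y := y) (fun i j => hxy _ _)
    (fun i j hij => hx _ _ (σ.injective.ne hij)) hy
    (by simpa only [Function.comp_apply, Equiv.sum_comp] using hS) z hz
  have hK : thetaCauchy τ (x ∘ σ) y = (thetaCauchy τ x y).submatrix σ (Equiv.refl _) := rfl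
  rw [hK, Matrix.inv_submatrix_equiv] at h
  simp only [Function.comp_apply, Matrix.vecMul, dotProduct, Matrix.submatrix_apply,
    Equiv.refl_apply, hσ] at h
  rw [Equiv.sum_comp σ x,
    prod_erase_comp_perm σ 0 (fun i => theta1 τ (z - x i) / theta1 τ (x l - x i)), hσ] at h
  exact h

theorem thetaCauchy_transpose (τ : ℂ) {n : ℕ} (x y : Fin n → ℂ) :
    (thetaCauchy τ x y).transpose = -thetaCauchy τ y x := by
  ext i j
  simp only [thetaCauchy, Matrix.transpose_apply, Matrix.of_apply, Matrix.neg_apply]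
  rw [theta1_sub_comm, ← theta3_neg, neg_sub, div_neg]

theorem thetaCauchy_inv_mulVec {τ : ℂ} (hτ : 0 < τ.im) {n : ℕ} {x y : Fin n → ℂ}
    (hxy : ∀ i j, theta1 τ (x i - y j) ≠ 0)
    (hx : ∀ i j, i ≠ j → theta1 τ (x i - x j) ≠ 0) (hy : ∀ i j, i ≠ j → theta1 τ (y i - y j) ≠ 0)
    (hS : theta3 τ (∑ i, x i - ∑ i, y i) ≠ 0) (z : ℂ) (hz : ∀ i, theta1 τ (x i - z) ≠ 0)
    (k : Fin n) :
    Matrix.mulVec (thetaCauchy τ x y)⁻¹ (fun i => theta3 τ (x i - z) / theta1 τ (x i - z)) k =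
      theta3 τ (y k - z + (∑ i, x i - ∑ i, y i)) / theta3 τ (∑ i, x i - ∑ i, y i) *
        (∏ i, theta1 τ (y k - x i) / theta1 τ (z - x i)) *
        ∏ i ∈ Finset.univ.erase k, theta1 τ (z - y i) / theta1 τ (y k - y i) := by
  have hS' : theta3 τ (∑ i, y i - ∑ i, x i) = theta3 τ (∑ i, x i - ∑ i, y i) := by
    rw [← theta3_neg, neg_sub]
  have hs : ∀ a b, theta1 τ (a - b) ≠ 0 → theta1 τ (b - a) ≠ 0 := fun a b h => by
    rw [theta1_sub_comm]
    exact neg_ne_zero.2 h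
  have h := vecMul_thetaCauchy_inv hτ (x := y) (y := x) (fun i j => hs _ _ (hxy j i)) hy hx
    (by rwa [hS']) z (fun i => hs _ _ (hz i)) k
  have e : z - y k + (∑ i, y i - ∑ i, x i) = -(y k - z + (∑ i, x i - ∑ i, y i)) := by ring
  rw [hS', e, theta3_neg] at h
  rw [← h, ← Matrix.vecMul_transpose, Matrix.transpose_nonsing_inv, thetaCauchy_transpose]
  have hdet := det_thetaCauchy_ne_zero hτ (x := y) (y := x) (fun i j => hs _ _ (hxy j i)) hy hx
    (by rwa [hS'])
  have hneg : (-thetaCauchy τ y x)⁻¹ = -(thetaCauchy τ y x)⁻¹ := by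
    refine Matrix.inv_eq_left_inv ?_
    rw [neg_mul_neg, Matrix.nonsing_inv_mul _ (isUnit_iff_ne_zero.2 hdet)]
  rw [hneg, Matrix.vecMul_neg, ← Matrix.neg_vecMul]
  congr 2
  funext i
  rw [Pi.neg_apply, theta1_sub_comm, ← theta3_neg, neg_sub, div_neg, neg_neg]

/-! ### The Jacobi elliptic functions -/

theorem dnDivSn_eq_theta {τ : ℂ} (hτ : 0 < τ.im) {u : ℂ}
    (hu : theta1 τ (u / theta3 τ 0 ^ 2) ≠ 0) :
    dnDivSn τ u = theta2 τ 0 * theta4 τ 0 / theta3 τ 0 ^ 2 *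
      (theta3 τ (u / theta3 τ 0 ^ 2) / theta1 τ (u / theta3 τ 0 ^ 2)) := by
  have h2 := theta2_zero_ne_zero hτ
  have h3 := theta3_zero_ne_zero hτ
  have c1 : Continuous fun w => theta1 τ (w / theta3 τ 0 ^ 2) :=
    (continuous_theta1 hτ).comp (by fun_prop)
  have c3 : Continuous fun w => theta3 τ (w / theta3 τ 0 ^ 2) :=
    (continuous_theta3 hτ).comp (by fun_prop)
  have hlim : Filter.Tendsto (fun w => theta2 τ 0 * theta4 τ 0 / theta3 τ 0 ^ 2 *
      (theta3 τ (w / theta3 τ 0 ^ 2) / theta1 τ (w / theta3 τ 0 ^ 2))) (nhdsWithin u {u}ᶜ)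
      (nhds (theta2 τ 0 * theta4 τ 0 / theta3 τ 0 ^ 2 *
      (theta3 τ (u / theta3 τ 0 ^ 2) / theta1 τ (u / theta3 τ 0 ^ 2)))) :=
    (continuousAt_const.mul (c3.continuousAt.div c1.continuousAt hu)).tendsto.mono_left
      nhdsWithin_le_nhds
  refine (hlim.congr' ?_).limUnder_eq
  have h4 := eventually_ne_zero_of_entire (f := fun w => theta4 τ (w / theta3 τ 0 ^ 2))
    ((differentiable_theta4 hτ).comp (by fun_prop)) (w := 0)
    (by simpa using theta4_zero_ne_zero hτ) u
  have h1 := (c1.continuousAt.eventually_ne hu).filter_mono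
    (nhdsWithin_le_nhds (s := ({u}ᶜ : Set ℂ)))
  filter_upwards [h4, h1] with w hw4 hw1
  rw [dn, sn]
  field_simp

theorem cn_eq_theta {τ : ℂ} (u : ℂ) :
    cn τ u = I * (theta4 τ 0 / theta2 τ 0) *
      (theta3 τ (u / theta3 τ 0 ^ 2 + Real.pi * τ / 2) /
        theta1 τ (u / theta3 τ 0 ^ 2 + Real.pi * τ / 2)) := by
  have h : ∀ e p q : ℂ, e ≠ 0 → e * p / (I * e * q) = -I * (p / q) := by
    intro e p q he
    rw [mul_right_comm I e q, mul_comm (I * q) e, mul_div_mul_left _ _ he, ← div_div, div_I]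
    ring
  rw [cn, theta3_add_half_period, theta1_add_pi_mul_div_two, h _ _ _ (exp_ne_zero _)]
  linear_combination (theta4 τ 0 / theta2 τ 0 *
    (theta2 τ (u / theta3 τ 0 ^ 2) / theta4 τ (u / theta3 τ 0 ^ 2))) * I_sq

theorem inv_smul_of_ne_zero {K ι : Type*} [Field K] [Fintype ι] [DecidableEq ι]
    (A : Matrix ι ι K) {c : K} (hc : c ≠ 0) (hA : A.det ≠ 0) : (c • A)⁻¹ = c⁻¹ • A⁻¹ :=
  Matrix.inv_smul' A (Units.mk0 c hc) (isUnit_iff_ne_zero.2 hA)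

end EllipticCauchy

theorem mainTheorem4 (τ : ℂ) (hτ : 0 < τ.im) (N : ℕ) (hN : 1 ≤ N) (u v x y : Fin N → ℂ)
    (hx : ∀ i, x i = u i / theta3 τ 0 ^ 2) (hy : ∀ i, y i = v i / theta3 τ 0 ^ 2)
    (Φ Ψ : Matrix (Fin N) (Fin N) ℂ)
    (hΦ : ∀ i j, Φ i j = dnDivSn τ (u i - v j))
    (hΨ : ∀ i j, Ψ i j = cn τ (u i - v j))
    -- no entry of `Φ` has a pole
    (hxy : ∀ i j, theta1 τ (x i - y j) ≠ 0) :
    -- the determinant of `Φ`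
    (Φ.det =
      theta2 τ 0 ^ N * theta4 τ 0 ^ N / theta3 τ 0 ^ (N + 1)
        * exp (-I * (∑ i, x i - ∑ i, y i - Real.pi * τ / 4))
        * theta1 τ (∑ i, x i - ∑ i, y i + Real.pi / 2 - Real.pi * τ / 2)
        * ((∏ i, ∏ j ∈ Finset.Ioi i, theta1 τ (x i - x j) * theta1 τ (y j - y i))
            / ∏ i, ∏ j, theta1 τ (x i - y j))) ∧
    ((∀ i j, i ≠ j → theta1 τ (x i - x j) ≠ 0) →
      (∀ i j, i ≠ j → theta1 τ (y i - y j) ≠ 0) →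
      theta1 τ (∑ i, x i - ∑ i, y i + Real.pi / 2 - Real.pi * τ / 2) ≠ 0 →
      -- `Φ` is invertible, and the entries of its inverse
      IsUnit Φ ∧
      (∀ m n, Φ⁻¹ m n =
        -(theta3 τ 0 / (theta2 τ 0 * theta4 τ 0))
          * (exp (I * (x n - y m))
              * theta1 τ (∑ i ∈ Finset.univ.erase n, x i - ∑ i ∈ Finset.univ.erase m, y i
                  + Real.pi / 2 - Real.pi * τ / 2)
              / (theta1 τ (∑ i, x i - ∑ i, y i + Real.pi / 2 - Real.pi * τ / 2)
                  * theta1 τ (x n - y m)))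
          * (((∏ i, theta1 τ (x n - y i)) * ∏ i, theta1 τ (y m - x i))
              / ((∏ i ∈ Finset.univ.erase n, theta1 τ (x n - x i))
                  * ∏ i ∈ Finset.univ.erase m, theta1 τ (y m - y i)))) ∧
      -- if moreover no entry of `Ψ` has a pole, the entries of the two products
      ((∀ i j, theta4 τ (x i - y j) ≠ 0) →
        (∀ l n, (Ψ * Φ⁻¹) l n =
          I * exp (I * (x n - x l - Real.pi * τ / 2))
            * (theta3 τ 0 ^ 2 / theta2 τ 0 ^ 2)
            * (theta1 τ (x l - x n + ∑ i, x i - ∑ i, y i + Real.pi / 2)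
                / theta1 τ (∑ i, x i - ∑ i, y i + Real.pi / 2 - Real.pi * τ / 2))
            * (∏ i, theta1 τ (x n - y i) / theta1 τ (x l - y i + Real.pi * τ / 2))
            * ∏ i ∈ Finset.univ.erase n,
                theta1 τ (x l - x i + Real.pi * τ / 2) / theta1 τ (x n - x i)) ∧
        (∀ m l, (Φ⁻¹ * Ψ) m l =
          I * exp (I * (y l - y m - Real.pi * τ / 2))
            * (theta3 τ 0 ^ 2 / theta2 τ 0 ^ 2)
            * (theta1 τ (y m - y l + ∑ i, x i - ∑ i, y i + Real.pi / 2)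
                / theta1 τ (∑ i, x i - ∑ i, y i + Real.pi / 2 - Real.pi * τ / 2))
            * (∏ i, theta1 τ (y m - x i) / theta1 τ (y l - x i - Real.pi * τ / 2))
            * ∏ i ∈ Finset.univ.erase m,
                theta1 τ (y l - y i - Real.pi * τ / 2) / theta1 τ (y m - y i)))) := by
  have h2 := theta2_zero_ne_zero hτ
  have h3 := theta3_zero_ne_zero hτ
  have h4 := theta4_zero_ne_zero hτ
  have hsub : ∀ i j, (u i - v j) / theta3 τ 0 ^ 2 = x i - y j := fun i j => by
    rw [hx, hy, sub_div]
  have hc : theta2 τ 0 * theta4 τ 0 / theta3 τ 0 ^ 2 ≠ 0 :=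
    div_ne_zero (mul_ne_zero h2 h4) (pow_ne_zero _ h3)
  have hK : Φ = (theta2 τ 0 * theta4 τ 0 / theta3 τ 0 ^ 2) • thetaCauchy τ x y := by
    ext i j
    rw [hΦ, dnDivSn_eq_theta hτ (by rw [hsub]; exact hxy i j), hsub]
    rfl
  have hS3 : ∀ s, theta1 τ (s + Real.pi / 2 - Real.pi * τ / 2) =
      exp (I * (s - Real.pi * τ / 4)) * theta3 τ s := theta1_add_half_period τ
  refine ⟨?_, fun hxx hyy hS => ?_⟩
  · have hdet := theta3_mul_det_thetaCauchy hτ x y hxy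
    have hexp : exp (-I * (∑ i, x i - ∑ i, y i - Real.pi * τ / 4)) *
        exp (I * (∑ i, x i - ∑ i, y i - Real.pi * τ / 4)) = 1 := by
      rw [← exp_add, neg_mul, neg_add_cancel, exp_zero]
    rw [hK, Matrix.det_smul, Fintype.card_fin, hS3, mul_assoc (_ / _) (exp _), ← mul_assoc (exp _),
      hexp, one_mul]
    apply mul_left_cancel₀ h3
    rw [mul_left_comm, hdet, div_pow, mul_pow]
    field_simp
    ring
  · rw [hS3] at hS
    have hS' := right_ne_zero_of_mul hS
    have hdet := det_thetaCauchy_ne_zero hτ hxy hxx hyy hS'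
    have hinv : Φ⁻¹ = (theta2 τ 0 * theta4 τ 0 / theta3 τ 0 ^ 2)⁻¹ • (thetaCauchy τ x y)⁻¹ := by
      rw [hK, inv_smul_of_ne_zero _ hc hdet]
    refine ⟨?_, fun m n => ?_, fun hpole => ⟨fun l n => ?_, fun m l => ?_⟩⟩
    · rw [Matrix.isUnit_iff_isUnit_det, hK, Matrix.det_smul]
      exact isUnit_iff_ne_zero.2 (mul_ne_zero (pow_ne_zero _ hc) hdet)
    · have hs : ∑ i ∈ Finset.univ.erase n, x i - ∑ i ∈ Finset.univ.erase m, y i =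
          ∑ i, x i - ∑ i, y i - (x n - y m) := by
        rw [Finset.sum_erase_eq_sub (Finset.mem_univ n),
          Finset.sum_erase_eq_sub (Finset.mem_univ m)]
        ring
      have hexp : exp (I * (∑ i, x i - ∑ i, y i - Real.pi * τ / 4)) =
          exp (I * (x n - y m)) *
            exp (I * (∑ i, x i - ∑ i, y i - (x n - y m) - Real.pi * τ / 4)) := by
        rw [← exp_add]
        ring_nf
      rw [hinv, Matrix.smul_apply, thetaCauchy_inv_apply hτ hxy hxx hyy hS', smul_eq_mul, hS3, hS3,
        hs, hexp]
      have e1 := exp_ne_zero (I * (x n - y m))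
      have e2 := exp_ne_zero (I * (∑ i, x i - ∑ i, y i - (x n - y m) - Real.pi * τ / 4))
      generalize exp (I * (x n - y m)) = a at *
      generalize exp (I * (∑ i, x i - ∑ i, y i - (x n - y m) - Real.pi * τ / 4)) = b at *
      rw [← mul_assoc, ← mul_assoc a b, mul_assoc (a * b) (theta3 τ _) (theta1 τ _),
        mul_div_mul_left _ _ (mul_ne_zero e1 e2)]
      rw [← mul_assoc (_)⁻¹]
      congr 2
      field_simp
    · have hz : ∀ i, theta1 τ (x l + Real.pi * τ / 2 - y i) ≠ 0 := fun i => by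
        rw [add_sub_right_comm, theta1_add_pi_mul_div_two]
        exact mul_ne_zero (mul_ne_zero I_ne_zero (exp_ne_zero _)) (hpole l i)
      have hrow := vecMul_thetaCauchy_inv hτ hxy hxx hyy hS' (x l + Real.pi * τ / 2) hz n
      have hΨl : Ψ l = (I * (theta4 τ 0 / theta2 τ 0)) • fun j =>
          theta3 τ (x l + Real.pi * τ / 2 - y j) / theta1 τ (x l + Real.pi * τ / 2 - y j) := by
        funext j
        rw [hΨ, cn_eq_theta, hsub, Pi.smul_apply, smul_eq_mul, add_sub_right_comm]
      have e : x l + Real.pi * τ / 2 - x n + (∑ i, x i - ∑ i, y i) =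
          x l - x n + ∑ i, x i - ∑ i, y i + Real.pi * τ / 2 := by ring
      have hexp : exp (-I * (x l - x n + ∑ i, x i - ∑ i, y i + Real.pi * τ / 4)) *
          exp (I * (∑ i, x i - ∑ i, y i - Real.pi * τ / 4)) =
          exp (I * (x n - x l - Real.pi * τ / 2)) := by
        rw [← exp_add]
        ring_nf
      rw [Matrix.mul_apply_eq_vecMul, hΨl, hinv, Matrix.smul_vecMul, Matrix.vecMul_smul,
        Pi.smul_apply, Pi.smul_apply, hrow, e, theta3_add_half_period, hS3, theta1_add_pi_div_two,
        ← hexp]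
      simp only [add_sub_right_comm (x l) (Real.pi * τ / 2), smul_eq_mul]
      have e1 := exp_ne_zero (I * (∑ i, x i - ∑ i, y i - Real.pi * τ / 4))
      generalize ∏ i, theta1 τ (x n - y i) / theta1 τ (x l - y i + Real.pi * τ / 2) = P
      generalize ∏ i ∈ Finset.univ.erase n,
        theta1 τ (x l - x i + Real.pi * τ / 2) / theta1 τ (x n - x i) = Q
      field_simp
    · have hz : ∀ i, theta1 τ (x i - (y l - Real.pi * τ / 2)) ≠ 0 := fun i => by
        rw [← sub_add, theta1_add_pi_mul_div_two]
        exact mul_ne_zero (mul_ne_zero I_ne_zero (exp_ne_zero _)) (hpole i l)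
      have hcol := thetaCauchy_inv_mulVec hτ hxy hxx hyy hS' (y l - Real.pi * τ / 2) hz m
      have hΨl : (fun i => Ψ i l) = (I * (theta4 τ 0 / theta2 τ 0)) • fun i =>
          theta3 τ (x i - (y l - Real.pi * τ / 2)) / theta1 τ (x i - (y l - Real.pi * τ / 2)) := by
        funext i
        rw [hΨ, cn_eq_theta, hsub, Pi.smul_apply, smul_eq_mul, ← sub_add]
      have hmul : (Φ⁻¹ * Ψ) m l = Matrix.mulVec Φ⁻¹ (fun i => Ψ i l) m := rfl
      have e : y m - (y l - Real.pi * τ / 2) + (∑ i, x i - ∑ i, y i) =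
          y m - y l + ∑ i, x i - ∑ i, y i + Real.pi * τ / 2 := by ring
      have hexp : exp (-I * (y m - y l + ∑ i, x i - ∑ i, y i + Real.pi * τ / 4)) *
          exp (I * (∑ i, x i - ∑ i, y i - Real.pi * τ / 4)) =
          exp (I * (y l - y m - Real.pi * τ / 2)) := by
        rw [← exp_add]
        ring_nf
      rw [hmul, hΨl, hinv, Matrix.smul_mulVec, Matrix.mulVec_smul,
        Pi.smul_apply, Pi.smul_apply, hcol, e, theta3_add_half_period, hS3, theta1_add_pi_div_two,
        ← hexp]
      simp only [sub_right_comm (y l) (Real.pi * τ / 2), smul_eq_mul]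
      have e1 := exp_ne_zero (I * (∑ i, x i - ∑ i, y i - Real.pi * τ / 4))
      generalize ∏ i, theta1 τ (y m - x i) / theta1 τ (y l - x i - Real.pi * τ / 2) = P
      generalize ∏ i ∈ Finset.univ.erase m,
        theta1 τ (y l - y i - Real.pi * τ / 2) / theta1 τ (y m - y i) = Q
      field_simp
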